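/- Let $n_a<n_x$, let $\theta$ range over $\mathbb{R}^d$, and fix a state $x_{t-1}\in\mathbb{R}^{n_x}$. Let $\tau_{x_{t-1}}:\mathbb{R}^{n_a}\to\mathbb{R}^{n_x}$ be smooth ($C^\infty$) and injective, with image $\mathcal{M}_{x_{t-1}}=\tau_{x_{t-1}}(\mathbb{R}^{n_a})$. For every $\theta$ let $\pi_\theta(\cdot\,|\,x_{t-1})$ be a probability density on $\mathbb{R}^{n_a}$, and let the transition density $f_\theta(\cdot\,|\,x_{t-1})\ge 0$ be a density, with respect to the $n_a$-dimensional surface (normalised Hausdorff) measure on $\mathcal{M}_{x_{t-1}}$, of the law of $\tau_{x_{t-1}}(a)$ for $a\sim\pi_\theta(\cdot\,|\,x_{t-1})$, extended by $0$ outside $\mathcal{M}_{x_{t-1}}$. Then: (a) Every $x_t\in\mathcal{M}_{x_{t-1}}$ is reached by a unique action $a_t$, i.e. $\tau_{x_{t-1}}(a_t)=x_t$. (b) Let $x_t\in\mathcal{M}_{x_{t-1}}$, let $a_t$ be this action, and let $\theta\in\mathbb{R}^d$. Suppose that the Jacobian of $\tau_{x_{t-1}}$ at $a_t$ has rank $n_a$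 and that, for all $\theta'$ in a neighbourhood of $\theta$, $\pi_{\theta'}(a_t\,|\,x_{t-1})>0$ and the functions $a\mapsto\pi_{\theta'}(a\,|\,x_{t-1})$ and $a\mapsto f_{\theta'}(\tau_{x_{t-1}}(a)\,|\,x_{t-1})$ are continuous at $a_t$. Then $\log f_{\theta'}(x_t\,|\,x_{t-1})$ is differentiable in $\theta'$ at $\theta$ if and only if $\log\pi_{\theta'}(a_t\,|\,x_{t-1})$ is, and in that case $$\nabla_\theta\log f_\theta(x_t\,|\,x_{t-1})=\nabla_\theta\log\pi_\theta(a_t\,|\,x_{t-1}).$$ (c) Suppose instead only that $\theta\mapsto\pi_\theta(a\,|\,x_{t-1})$ and $\theta\mapsto f_\theta(y\,|\,x_{t-1})$ are continuous for every $a\in\mathbb{R}^{n_a}$ and every $y\in\mathcal{M}_{x_{t-1}}$. Then for almost every $x_t\in\mathcal{M}_{x_{t-1}}$ with respect to the surface measure, the conclusion of (b) holds, with $a_t$ the action reaching $x_t$, for all $\theta$ with $\pi_\theta(a_t\,|\,x_{t-1})>0$. -/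

import Mathlib

open MeasureTheory Filter Topology
open scoped Gradient ContDiff

/-- `p` is a probability density on `ℝⁿ` with respect to Lebesgue measure. -/
structure IsProbDensity {n : ℕ} (p : EuclideanSpace ℝ (Fin n) → ℝ) : Prop where
  measurable : Measurable p
  nonneg : ∀ a, 0 ≤ p a
  lintegral_eq_one : ∫⁻ a, ENNReal.ofReal (p a) = 1

/-- The law of the next state `T a`, where the action `a` has density `p`. -/
noncomputable def nextStateLaw {m n : ℕ} (T : EuclideanSpace ℝ (Fin m) → EuclideanSpace ℝ (Fin n))
    (p : EuclideanSpace ℝ (Fin m) → ℝ) : Measure (EuclideanSpace ℝ (Fin n)) :=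
  (volume.withDensity fun a => ENNReal.ofReal (p a)).map T

/-- The `m`-dimensional surface measure on the set `T(ℝᵐ)` of reachable next states: the Hausdorff
measure of dimension `m`, normalised to agree with Lebesgue measure on `ℝᵐ`. -/
noncomputable def surfaceMeasure {m n : ℕ}
    (T : EuclideanSpace ℝ (Fin m) → EuclideanSpace ℝ (Fin n)) :
    Measure (EuclideanSpace ℝ (Fin n)) :=
  (Measure.euclideanHausdorffMeasure m).restrict (Set.range T)

/-- `f` is a density of the law of the next state with respect to the surface measure on the set
`T(ℝᵐ)` of reachable next states, and vanishes off this set. -/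
structure IsTransitionDensity {m n : ℕ}
    (T : EuclideanSpace ℝ (Fin m) → EuclideanSpace ℝ (Fin n))
    (p : EuclideanSpace ℝ (Fin m) → ℝ) (f : EuclideanSpace ℝ (Fin n) → ℝ) : Prop where
  measurable : Measurable f
  nonneg : ∀ y, 0 ≤ f y
  eq_zero_of_notMem : ∀ y, y ∉ Set.range T → f y = 0
  law_eq : nextStateLaw T p = (surfaceMeasure T).withDensity fun y => ENNReal.ofReal (f y)

/-!
Pull the surface measure back along the injective motion map `T` to a measure `ν` on the action
space, `ν s = μHE (T '' s)`. Since `T` is `C¹`, it is locally Lipschitz, so `ν` is locally bounded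
by a multiple of Lebesgue measure; hence `ν` is `σ`-finite, absolutely continuous, and has a
locally bounded density `J` (the area formula would identify `J` as the Jacobian of `T`, but only
its existence matters). Pulling back the identity that defines a transition density `f` of a
policy density `p` gives `p = J * (f ∘ T)` almost everywhere, with the same `J` for every
parameter (`IsTransitionDensity.ae_eq_jacobian_mul`).

The factor `J` does not depend on the parameter, so it drops out of the score. In the almost
everywhere statement, the identity holds off one null set of actions for a countable dense set of
parameters, and then for all parameters by continuity. In the pointwise statement `J` need not be
defined at the given action; eliminating it between two parameters gives
`p * (f' ∘ T) = p' * (f ∘ T)` almost everywhere, which holds at each point of continuity, and local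
boundedness of `J` makes `f (T a)` positive where `p a` is. In both cases the two log-densities
differ by a constant near the given parameter.
-/

/-! ### The pullback of the surface measure -/

/-- The surface measure in the coordinates given by `T`: the measure `s ↦ μHE (T '' s)` on the
space of actions. -/
noncomputable def pullbackSurfaceMeasure {m n : ℕ}
    (T : EuclideanSpace ℝ (Fin m) → EuclideanSpace ℝ (Fin n)) :
    Measure (EuclideanSpace ℝ (Fin m)) :=
  (Measure.euclideanHausdorffMeasure m).comap T

/-- The density of the pulled back surface measure with respect to Lebesgue measure. It is a
Radon–Nikodym derivative, so it is meaningful only up to null sets. -/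
noncomputable def surfaceJacobian {m n : ℕ}
    (T : EuclideanSpace ℝ (Fin m) → EuclideanSpace ℝ (Fin n)) (a : EuclideanSpace ℝ (Fin m)) : ℝ :=
  ((pullbackSurfaceMeasure T).rnDeriv volume a).toReal

section Pullback

variable {m n : ℕ} {T : EuclideanSpace ℝ (Fin m) → EuclideanSpace ℝ (Fin n)}

lemma euclideanHausdorffMeasure_image_le_of_lipschitzOnWith {K : NNReal}
    {s : Set (EuclideanSpace ℝ (Fin m))} (h : LipschitzOnWith K T s) :
    Measure.euclideanHausdorffMeasure m (T '' s) ≤ (K : ENNReal) ^ m * volume s := by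
  rw [← EuclideanSpace.euclideanHausdorffMeasure_eq_volume m,
    Measure.euclideanHausdorffMeasure_def, Measure.euclideanHausdorffMeasure_def,
    Measure.smul_apply, Measure.smul_apply, mul_smul_comm]
  gcongr
  simpa using h.hausdorffMeasure_image_le (d := m) (by positivity)

lemma measurableEmbedding_of_contDiff (hT : ContDiff ℝ ∞ T) (hinj : Function.Injective T) :
    MeasurableEmbedding T :=
  hT.continuous.measurableEmbedding hinj

lemma exists_pullbackSurfaceMeasure_le (hT : ContDiff ℝ ∞ T) (hinj : Function.Injective T)
    (a : EuclideanSpace ℝ (Fin m)) :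
    ∃ C : NNReal, ∃ t ∈ 𝓝 a, ∀ s ⊆ t, pullbackSurfaceMeasure T s ≤ C * volume s := by
  obtain ⟨K, t, ht, hK⟩ := ((hT.of_le (by simp)).contDiffAt (x := a)).exists_lipschitzOnWith
  refine ⟨K ^ m, t, ht, fun s hs => ?_⟩
  rw [pullbackSurfaceMeasure, (measurableEmbedding_of_contDiff hT hinj).comap_apply]
  simpa using euclideanHausdorffMeasure_image_le_of_lipschitzOnWith (hK.mono hs)

lemma sigmaFinite_pullbackSurfaceMeasure (hT : ContDiff ℝ ∞ T) (hinj : Function.Injective T) :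
    SigmaFinite (pullbackSurfaceMeasure T) := by
  have : IsLocallyFiniteMeasure (pullbackSurfaceMeasure T) := ⟨fun a => by
    obtain ⟨C, t, ht, hC⟩ := exists_pullbackSurfaceMeasure_le hT hinj a
    obtain ⟨u, hu, hu'⟩ := (volume : Measure (EuclideanSpace ℝ (Fin m))).finiteAt_nhds a
    refine ⟨t ∩ u, inter_mem ht hu, (hC _ Set.inter_subset_left).trans_lt ?_⟩
    exact ENNReal.mul_lt_top ENNReal.coe_lt_top
      ((measure_mono Set.inter_subset_right).trans_lt hu')⟩
  infer_instance

lemma pullbackSurfaceMeasure_absolutelyContinuous (hT : ContDiff ℝ ∞ T)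
    (hinj : Function.Injective T) : pullbackSurfaceMeasure T ≪ volume := by
  intro s hs
  refine measure_null_of_locally_null s fun a _ => ?_
  obtain ⟨C, t, ht, hC⟩ := exists_pullbackSurfaceMeasure_le hT hinj a
  refine ⟨s ∩ t, inter_mem self_mem_nhdsWithin (mem_nhdsWithin_of_mem_nhds ht), ?_⟩
  refine le_antisymm ((hC _ Set.inter_subset_right).trans ?_) zero_le
  rw [measure_mono_null Set.inter_subset_left hs, mul_zero]

lemma map_pullbackSurfaceMeasure (hT : ContDiff ℝ ∞ T) (hinj : Function.Injective T) :
    (pullbackSurfaceMeasure T).map T = surfaceMeasure T :=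
  (measurableEmbedding_of_contDiff hT hinj).map_comap _

/-- A property of actions that holds Lebesgue-almost everywhere holds for the actions reaching
surface-almost every state. -/
lemma ae_surfaceMeasure_of_ae (hT : ContDiff ℝ ∞ T) (hinj : Function.Injective T)
    {P : EuclideanSpace ℝ (Fin m) → Prop} (h : ∀ᵐ a, P a) :
    ∀ᵐ y ∂(surfaceMeasure T), ∀ a, T a = y → P a := by
  rw [← map_pullbackSurfaceMeasure hT hinj,
    (measurableEmbedding_of_contDiff hT hinj).ae_map_iff]
  filter_upwards [(pullbackSurfaceMeasure_absolutelyContinuous hT hinj).ae_le h] with a ha b hb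
  rwa [hinj hb]

/-! ### The Jacobian factor -/

lemma withDensity_rnDeriv_pullbackSurfaceMeasure (hT : ContDiff ℝ ∞ T)
    (hinj : Function.Injective T) :
    volume.withDensity ((pullbackSurfaceMeasure T).rnDeriv volume) = pullbackSurfaceMeasure T := by
  have := sigmaFinite_pullbackSurfaceMeasure hT hinj
  exact Measure.withDensity_rnDeriv_eq _ _ (pullbackSurfaceMeasure_absolutelyContinuous hT hinj)

lemma exists_ae_surfaceJacobian_le (hT : ContDiff ℝ ∞ T) (hinj : Function.Injective T)
    (a : EuclideanSpace ℝ (Fin m)) :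
    ∃ C : ℝ, ∀ᶠ b in 𝓝 a ⊓ ae volume, surfaceJacobian T b ≤ C := by
  obtain ⟨C, t, ht, hC⟩ := exists_pullbackSurfaceMeasure_le hT hinj a
  obtain ⟨u, hut, hu, hau⟩ := mem_nhds_iff.1 ht
  have key : (pullbackSurfaceMeasure T).rnDeriv volume ≤ᵐ[volume.restrict u] fun _ => C := by
    refine ae_le_of_forall_setLIntegral_le_of_sigmaFinite (Measure.measurable_rnDeriv _ _)
      fun s hs _ => ?_
    rw [Measure.restrict_restrict hs, ← withDensity_apply _ (hs.inter hu.measurableSet),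
      withDensity_rnDeriv_pullbackSurfaceMeasure hT hinj, lintegral_const,
      Measure.restrict_apply_univ]
    exact hC _ (Set.inter_subset_right.trans hut)
  refine ⟨C, ?_⟩
  rw [EventuallyLE, ae_restrict_iff' hu.measurableSet] at key
  filter_upwards [mem_inf_of_left (hu.mem_nhds hau), mem_inf_of_right key] with b hb h
  exact ENNReal.toReal_mono ENNReal.coe_ne_top (h hb)

/-- Change of variables: the policy density is the transition density times a Jacobian factor that
depends on the motion map alone. -/
lemma IsTransitionDensity.ae_eq_jacobian_mul (hT : ContDiff ℝ ∞ T) (hinj : Function.Injective T)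
    {p : EuclideanSpace ℝ (Fin m) → ℝ} {f : EuclideanSpace ℝ (Fin n) → ℝ}
    (hp : IsProbDensity p) (hf : IsTransitionDensity T p f) :
    ∀ᵐ a, p a = surfaceJacobian T a * f (T a) := by
  have hTm := measurableEmbedding_of_contDiff hT hinj
  have := sigmaFinite_pullbackSurfaceMeasure hT hinj
  have hfm : Measurable fun y => ENNReal.ofReal (f y) := hf.measurable.ennreal_ofReal
  have hfTm : Measurable fun a => ENNReal.ofReal (f (T a)) := hfm.comp hTm.measurable
  have hmap : (volume.withDensity fun a => ENNReal.ofReal (p a)).map T =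
      ((pullbackSurfaceMeasure T).withDensity fun a => ENNReal.ofReal (f (T a))).map T := by
    refine hf.law_eq.trans ?_
    ext s hs
    rw [withDensity_apply _ hs, hTm.map_apply, withDensity_apply _ (hTm.measurable hs),
      ← map_pullbackSurfaceMeasure hT hinj, setLIntegral_map hs hfm hTm.measurable]
  have hpull := congrArg (Measure.comap T) hmap
  rw [hTm.comap_map, hTm.comap_map, ← withDensity_rnDeriv_pullbackSurfaceMeasure hT hinj,
    ← withDensity_mul _ (Measure.measurable_rnDeriv _ _) hfTm,
    withDensity_eq_iff_of_sigmaFinite hp.measurable.ennreal_ofReal.aemeasurable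
      ((Measure.measurable_rnDeriv _ _).mul hfTm).aemeasurable] at hpull
  filter_upwards [hpull] with a ha
  have := congrArg ENNReal.toReal ha
  simpa [surfaceJacobian, ENNReal.toReal_ofReal (hp.nonneg a), hf.nonneg] using this

end Pullback

/-! ### Almost everywhere relations at points of continuity -/

lemma neBot_nhds_inf_ae {m : ℕ} (a : EuclideanSpace ℝ (Fin m)) :
    (𝓝 a ⊓ ae (volume : Measure (EuclideanSpace ℝ (Fin m)))).NeBot := by
  rw [inf_neBot_iff]
  intro s hs t ht
  exact mem_closure_iff_nhds.1 (Measure.dense_of_ae ht a) s hs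

section Pointwise

variable {m n : ℕ} {T : EuclideanSpace ℝ (Fin m) → EuclideanSpace ℝ (Fin n)}
  {p q : EuclideanSpace ℝ (Fin m) → ℝ} {f g : EuclideanSpace ℝ (Fin n) → ℝ}
  {a : EuclideanSpace ℝ (Fin m)}

/-- Eliminating the Jacobian factor between two policies. -/
lemma IsTransitionDensity.mul_eq_mul (hT : ContDiff ℝ ∞ T) (hinj : Function.Injective T)
    (hp : IsProbDensity p) (hf : IsTransitionDensity T p f)
    (hq : IsProbDensity q) (hg : IsTransitionDensity T q g)
    (hpa : ContinuousAt p a) (hfa : ContinuousAt (fun b => f (T b)) a)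
    (hqa : ContinuousAt q a) (hga : ContinuousAt (fun b => g (T b)) a) :
    p a * g (T a) = q a * f (T a) := by
  have := neBot_nhds_inf_ae a
  have hnhds : 𝓝 a ⊓ ae volume ≤ 𝓝 a := inf_le_left
  refine tendsto_nhds_unique_of_eventuallyEq ((hpa.mul hga).tendsto.mono_left hnhds)
    ((hqa.mul hfa).tendsto.mono_left hnhds) (mem_inf_of_right ?_)
  filter_upwards [hf.ae_eq_jacobian_mul hT hinj hp, hg.ae_eq_jacobian_mul hT hinj hq] with b h h'
  change p b * g (T b) = q b * f (T b)
  rw [h, h']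
  ring

lemma IsTransitionDensity.pos_of_pos (hT : ContDiff ℝ ∞ T) (hinj : Function.Injective T)
    (hp : IsProbDensity p) (hf : IsTransitionDensity T p f)
    (hpa : ContinuousAt p a) (hfa : ContinuousAt (fun b => f (T b)) a) (h0 : 0 < p a) :
    0 < f (T a) := by
  have := neBot_nhds_inf_ae a
  have hnhds : 𝓝 a ⊓ ae volume ≤ 𝓝 a := inf_le_left
  obtain ⟨C, hC⟩ := exists_ae_surfaceJacobian_le hT hinj a
  have hle : p a ≤ C * f (T a) := by
    refine le_of_tendsto_of_tendsto (hpa.tendsto.mono_left hnhds)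
      ((hfa.tendsto.const_mul C).mono_left hnhds) ?_
    filter_upwards [hC, mem_inf_of_right (hf.ae_eq_jacobian_mul hT hinj hp)] with b hb h
    rw [h]
    exact mul_le_mul_of_nonneg_right hb (hf.nonneg _)
  refine (hf.nonneg _).lt_of_ne fun h => ?_
  rw [← h, mul_zero] at hle
  exact hle.not_gt h0

end Pointwise

/-! ### Scores of proportional densities -/

lemma score_eq_of_eventually_eq_mul {E : Type*} [NormedAddCommGroup E] [InnerProductSpace ℝ E]
    [CompleteSpace E] {F G : E → ℝ} {θ : E} {c : ℝ} (hc : c ≠ 0)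
    (h : ∀ᶠ θ' in 𝓝 θ, 0 < G θ' ∧ F θ' = c * G θ') :
    (DifferentiableAt ℝ (fun θ' => Real.log (F θ')) θ ↔
      DifferentiableAt ℝ (fun θ' => Real.log (G θ')) θ) ∧
    ∇ (fun θ' => Real.log (F θ')) θ = ∇ (fun θ' => Real.log (G θ')) θ := by
  have hlog : (fun θ' => Real.log (F θ')) =ᶠ[𝓝 θ] fun θ' => Real.log c + Real.log (G θ') := by
    filter_upwards [h] with θ' hθ'
    rw [hθ'.2, Real.log_mul hc hθ'.1.ne']
  refine ⟨hlog.differentiableAt_iff.trans (differentiableAt_const_add_iff _), ?_⟩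
  rw [hlog.gradient_eq, gradient, gradient, fderiv_const_add]

theorem lemma1 {d na nx : ℕ} (hn : na < nx)
    -- motion model `τ x a`, policy density `π θ x a = π_θ(a | x)`,
    -- transition density `f θ x y = f_θ(y | x)`
    (τ : EuclideanSpace ℝ (Fin nx) → EuclideanSpace ℝ (Fin na) → EuclideanSpace ℝ (Fin nx))
    (π : EuclideanSpace ℝ (Fin d) → EuclideanSpace ℝ (Fin nx) → EuclideanSpace ℝ (Fin na) → ℝ)
    (f : EuclideanSpace ℝ (Fin d) → EuclideanSpace ℝ (Fin nx) → EuclideanSpace ℝ (Fin nx) → ℝ)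
    (x : EuclideanSpace ℝ (Fin nx))
    (hτ_smooth : ContDiff ℝ ∞ (τ x)) (hτ_inj : Function.Injective (τ x))
    (hπ : ∀ θ, IsProbDensity (π θ x))
    (hf : ∀ θ, IsTransitionDensity (τ x) (π θ x) (f θ x)) :
    -- the action leading from `x` to a given reachable state is unique
    (∀ y ∈ Set.range (τ x), ∃! a, τ x a = y) ∧
    -- the two scores agree at every point at which the Jacobian has full rank and
    -- the densities are continuous along the manifold, respectively in the action
    (∀ y ∈ Set.range (τ x), ∀ a, τ x a = y → ∀ θ,
      Function.Injective (fderiv ℝ (τ x) a) →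
      (∀ᶠ θ' in 𝓝 θ, 0 < π θ' x a ∧ ContinuousAt (π θ' x) a ∧
        ContinuousAt (fun b => f θ' x (τ x b)) a) →
      (DifferentiableAt ℝ (fun θ' => Real.log (f θ' x y)) θ ↔
        DifferentiableAt ℝ (fun θ' => Real.log (π θ' x a)) θ) ∧
      ∇ (fun θ' => Real.log (f θ' x y)) θ = ∇ (fun θ' => Real.log (π θ' x a)) θ) ∧
    -- without any regularity in the action or in the state, they agree almost everywhere
    ((∀ a, Continuous fun θ => π θ x a) →
      (∀ y ∈ Set.range (τ x), Continuous fun θ => f θ x y) →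
      ∀ᵐ y ∂(surfaceMeasure (τ x)), ∀ a, τ x a = y → ∀ θ, 0 < π θ x a →
        (DifferentiableAt ℝ (fun θ' => Real.log (f θ' x y)) θ ↔
          DifferentiableAt ℝ (fun θ' => Real.log (π θ' x a)) θ) ∧
        ∇ (fun θ' => Real.log (f θ' x y)) θ = ∇ (fun θ' => Real.log (π θ' x a)) θ) := by
  refine ⟨fun y hy => ?_, ?_, fun hπ_cont hf_cont => ?_⟩
  · obtain ⟨a, rfl⟩ := hy
    exact ⟨a, rfl, fun b hb => hτ_inj hb⟩
  · rintro _ - a rfl θ - h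
    obtain ⟨hpos, hpa, hfa⟩ := h.self_of_nhds
    have hfpos := (hf θ).pos_of_pos hτ_smooth hτ_inj (hπ θ) hpa hfa hpos
    refine score_eq_of_eventually_eq_mul (div_pos hfpos hpos).ne' ?_
    filter_upwards [h] with θ' hθ'
    have := (hf θ).mul_eq_mul hτ_smooth hτ_inj (hπ θ) (hπ θ') (hf θ') hpa hfa hθ'.2.1 hθ'.2.2
    refine ⟨hθ'.1, ?_⟩
    field_simp
    linarith
  · -- One null set serves a countable dense set of parameters; continuity extends the identity.
    have hall : ∀ᵐ a, ∀ θ, π θ x a = surfaceJacobian (τ x) a * f θ x (τ x a) := by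
      have hseq : ∀ᵐ a, ∀ k, π (TopologicalSpace.denseSeq _ k) x a =
          surfaceJacobian (τ x) a * f (TopologicalSpace.denseSeq _ k) x (τ x a) :=
        ae_all_iff.2 fun k => (hf _).ae_eq_jacobian_mul hτ_smooth hτ_inj (hπ _)
      filter_upwards [hseq] with a ha θ
      exact congrFun ((TopologicalSpace.denseRange_denseSeq _).equalizer (hπ_cont a)
        ((hf_cont _ ⟨a, rfl⟩).const_mul _) (funext ha)) θ
    filter_upwards [ae_surfaceMeasure_of_ae hτ_smooth hτ_inj hall] with y hy a hay θ hpos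
    subst hay
    have hJ : surfaceJacobian (τ x) a ≠ 0 := by
      intro h0
      rw [hy a rfl θ, h0, zero_mul] at hpos
      exact hpos.false
    refine score_eq_of_eventually_eq_mul (inv_ne_zero hJ) ?_
    filter_upwards [(hπ_cont a).continuousAt.eventually (lt_mem_nhds hpos)] with θ' hθ'
    refine ⟨hθ', ?_⟩
    rw [hy a rfl θ', inv_mul_cancel_left₀ hJ]
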